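/- Let $k\ge 1$ and let $X_1,\dots,X_{2k}$ be centred, jointly Normal random variables (possibly degenerate) with covariance matrix $V$. Put $Y_j=X_{2j-1}X_{2j}$ for $j=1,\dots,k$. Then $M(t_1,\dots,t_k)=\mathbb{E}\exp(t_1Y_1+\dots+t_kY_k)$ is finite for $t$ near $0$, $\ln M$ is $k$ times continuously differentiable at $0$, and the joint cumulant $$\kappa_{(1,2),\dots,(2k-1,2k)}=\left.\frac{\partial^{k}}{\partial t_1\cdots\partial t_k}\ln M(t_1,\dots,t_k)\right|_{t=0}$$ satisfies $$\kappa_{(1,2),\dots,(2k-1,2k)}=\sum_{p\in\tilde{\mathcal P}_{2k}}\ \prod_{\{i,j\}\in p}V_{ij}.$$ Here $\tilde{\mathcal P}_{2k}$ is the set of pairings of $\{1,\dots,2k\}$ (partitions into unordered pairs) built by the following cyclic scheme. Start from the list $\{1,2\},\{3,4\},\dots,\{2k-1,2k\}$ of original pairs. Keep the first pair fixed, reorder the remaining $k-1$ pairs arbitrarily, and interchange the two indices inside any of these remaining pairs, so that an arrangement $(a_1,a_2),(a_3,a_4),\dots,(a_{2k-1},a_{2k})$ with $a_1=1$, $a_2=2$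 results. Then shift by one index to get the pairing $\{a_2,a_3\},\{a_4,a_5\},\dots,\{a_{2k-2},a_{2k-1}\},\{a_{2k},a_1\}$. Moreover, $\tilde{\mathcal P}_{2k}$ has exactly $(k-1)!\,2^{k-1}$ elements. For $k\ge 2$ none of its elements contains an original pair $\{2j-1,2j\}$. It consists of exactly those pairings $p$ of $\{1,\dots,2k\}$ for which the graph on $\{1,\dots,2k\}$, whose edges are the pairs of $p$ together with the original pairs, is connected. -/

import Mathlib

open MeasureTheory ProbabilityTheory Filter Topology

namespace DoubletCumulant

noncomputable section

variable {Ω : Type*} [MeasurableSpace Ω]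

/-- The joint moment-generating function `t ↦ 𝔼 exp (∑ i, t i * Y i)` of finitely many random
variables. -/
def jointMGF {ι : Type*} [Fintype ι] (Y : ι → Ω → ℝ) (P : Measure Ω) (t : ι → ℝ) : ℝ :=
  ∫ ω, Real.exp (∑ i, t i * Y i ω) ∂P

/-- The logarithm of the joint moment-generating function. -/
def jointCGF {ι : Type*} [Fintype ι] (Y : ι → Ω → ℝ) (P : Measure Ω) (t : ι → ℝ) : ℝ :=
  Real.log (jointMGF Y P t)

/-- The joint cumulant of `Y 0, …, Y (ℓ - 1)`: the mixed partial derivative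
`∂^ℓ / ∂t_0 ⋯ ∂t_{ℓ-1}` of the logarithm of the joint moment-generating function at `t = 0`. -/
def jointCumulant {l : ℕ} (Y : Fin l → Ω → ℝ) (P : Measure Ω) : ℝ :=
  iteratedFDeriv ℝ l (jointCGF Y P) 0 (fun i => Pi.single i 1)

/-- The covariance matrix of a finite family of random variables. -/
def covMatrix {n : ℕ} (X : Fin n → Ω → ℝ) (P : Measure Ω) : Matrix (Fin n) (Fin n) ℝ :=
  Matrix.of fun i j => cov[X i, X j; P]

theorem covMatrix_comm {n : ℕ} (X : Fin n → Ω → ℝ) (P : Measure Ω) (i j : Fin n) :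
    covMatrix X P i j = covMatrix X P j i :=
  covariance_comm (X i) (X j)

/-- The entry of the covariance matrix at an unordered pair of indices. -/
def covEntry {n : ℕ} (X : Fin n → Ω → ℝ) (P : Measure Ω) : Sym2 (Fin n) → ℝ :=
  Sym2.lift ⟨fun i j => covMatrix X P i j, covMatrix_comm X P⟩

end

/-- A pairing of the `n` indices: a set of unordered pairs of distinct indices such that every
index lies in exactly one of them. -/
def IsPairing {n : ℕ} (p : Finset (Sym2 (Fin n))) : Prop :=
  (∀ e ∈ p, ¬ e.IsDiag) ∧ ∀ i : Fin n, ∃! e, e ∈ p ∧ i ∈ e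

/-- The first (`b = false`) or second (`b = true`) index of the `j`-th original pair
`{2j, 2j+1}`, counting from zero. -/
def idx {k : ℕ} (j : Fin k) (b : Bool) : Fin (2 * k) :=
  ⟨2 * j.val + b.toNat, by have := j.isLt; have := b.toNat_lt; omega⟩

/-- The original pairs `{2j, 2j+1}`, `j < k`. -/
def originalPairs (k : ℕ) : Finset (Sym2 (Fin (2 * k))) :=
  Finset.univ.image fun j => s(idx j false, idx j true)

/-- The random variables `X_{2j} X_{2j+1}`, `j < k`. -/
def doublets {Ω : Type*} {k : ℕ} (X : Fin (2 * k) → Ω → ℝ) : Fin k → Ω → ℝ :=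
  fun j ω => X (idx j false) ω * X (idx j true) ω

/-- List the original pairs in the order given by `π` and interchange the two indices of the pair
in place `j` when `ε j = true`. This is the entry `b` of the pair in place `j`. -/
def arrangement {k : ℕ} (π : Equiv.Perm (Fin k)) (ε : Fin k → Bool) (j : Fin k) (b : Bool) :
    Fin (2 * k) :=
  idx (π j) (xor b (ε j))

/-- The pairs obtained by shifting an arrangement by one index: the second entry in place `j` is
paired with the first entry in the cyclically next place. -/
def shiftedPairs {k : ℕ} (π : Equiv.Perm (Fin k)) (ε : Fin k → Bool) :
    Finset (Sym2 (Fin (2 * k))) :=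
  Finset.univ.image fun j => s(arrangement π ε j true, arrangement π ε (finRotate k j) false)

/-- The class of pairings built by the cyclic scheme: keep the first original pair fixed, permute
the other original pairs and interchange the indices inside them in all possible ways, then shift
each resulting arrangement by one index. -/
def cyclicPairings (k : ℕ) : Finset (Finset (Sym2 (Fin (2 * k)))) :=
  ((Finset.univ : Finset (Equiv.Perm (Fin k) × (Fin k → Bool))).filter
    fun a => ∀ j : Fin k, j.val = 0 → a.1 j = j ∧ a.2 j = false).image
      fun a => shiftedPairs a.1 a.2

/-- The graph on the `2k` indices whose edges are the pairs in `p` and the original pairs. -/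
def pairingGraph {k : ℕ} (p : Finset (Sym2 (Fin (2 * k)))) : SimpleGraph (Fin (2 * k)) :=
  SimpleGraph.fromEdgeSet (↑(p ∪ originalPairs k) : Set (Sym2 (Fin (2 * k))))

end DoubletCumulant

/-! Write `∑ t_j Y_j = xᵀA(t)x / 2` with `A(t) = ∑ t_j E_j` and `E_j` the symmetric 0-1 matrix of
the `j`-th original pair. Diagonalizing a Gaussian integral gives `M(t) = det(1 - V A(t))^(-1/2)`
near `0` (`eventually_jointMGF_doublets`).

The derivative of `ln M` along the first direction is half the trace of `(1 - V A)⁻¹ V E_0`, that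
is, one entry of the symmetric matrix `(1 - V A)⁻¹ V` (`fderiv_negHalfLogDet`). So the first pair
stays fixed and the factor `1/2` disappears. The other `k - 1` derivatives come from the Neumann
series: a sum over orders of the remaining pairs, in which each `E_j` contributes two orientations
(`prod_mul_pairMatrix_apply`). Each term is a product of entries of `V` around a cycle, and distinct
terms give distinct pairings (`shiftedPairs_injective`).

A pairing together with the original pairs forms alternating cycles; connectedness means that there
is only one, and following it from the first pair recovers an arrangement
(`mem_cyclicPairings_of_connected`). -/

namespace DoubletCumulant

open Matrix WithLp

/-! ### Exponentials of quadratic forms under the standard Gaussian law -/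

section GaussianQuadratic

theorem gaussianPDFReal_smul_exp_mul_sq (c x : ℝ) :
    gaussianPDFReal 0 1 x • Real.exp (c / 2 * x ^ 2) =
      (√(2 * Real.pi))⁻¹ * Real.exp (-((1 - c) / 2) * x ^ 2) := by
  rw [gaussianPDFReal_def, smul_eq_mul, mul_assoc, ← Real.exp_add]
  simp only [NNReal.coe_one, mul_one, sub_zero]
  congr 2
  ring

theorem integrable_exp_mul_sq_gaussianReal {c : ℝ} (hc : c < 1) :
    Integrable (fun x : ℝ => Real.exp (c / 2 * x ^ 2)) (gaussianReal 0 1) := by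
  rw [gaussianReal_of_var_ne_zero _ one_ne_zero,
    integrable_withDensity_iff_integrable_smul' (measurable_gaussianPDF 0 1)
      (ae_of_all _ fun x => gaussianPDF_lt_top)]
  simp only [toReal_gaussianPDF, gaussianPDFReal_smul_exp_mul_sq]
  exact (integrable_exp_neg_mul_sq (by linarith)).const_mul _

theorem integral_exp_mul_sq_gaussianReal {c : ℝ} (hc : c < 1) :
    ∫ x : ℝ, Real.exp (c / 2 * x ^ 2) ∂(gaussianReal 0 1) = (√(1 - c))⁻¹ := by
  have h1 : 0 < 1 - c := by linarith
  rw [integral_gaussianReal_eq_integral_smul one_ne_zero]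
  simp only [gaussianPDFReal_smul_exp_mul_sq]
  rw [integral_const_mul, integral_gaussian, ← Real.sqrt_inv, ← Real.sqrt_inv,
    ← Real.sqrt_mul (by positivity)]
  congr 1
  field_simp

variable {ι : Type*} [Fintype ι] [DecidableEq ι]

/-- In coordinates along an orthonormal eigenbasis a quadratic form is a weighted sum of squares. -/
theorem dotProduct_mulVec_sum_eigenvectorBasis {B : Matrix ι ι ℝ} (hB : B.IsHermitian)
    (x : ι → ℝ) :
    (∑ i, x i • hB.eigenvectorBasis i).ofLp ⬝ᵥ (B *ᵥ (∑ i, x i • hB.eigenvectorBasis i).ofLp) =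
      ∑ i, hB.eigenvalues i * x i ^ 2 := by
  have h : B *ᵥ (∑ i, x i • hB.eigenvectorBasis i).ofLp =
      (∑ i, (hB.eigenvalues i * x i) • hB.eigenvectorBasis i).ofLp := by
    simp only [ofLp_sum, ofLp_smul, Matrix.mulVec_sum, Matrix.mulVec_smul,
      hB.mulVec_eigenvectorBasis, smul_smul, mul_comm]
  have h2 := hB.eigenvectorBasis.orthonormal.inner_sum (fun i => hB.eigenvalues i * x i) x
    Finset.univ
  rw [h]
  rw [EuclideanSpace.inner_eq_star_dotProduct] at h2
  simp only [star_trivial] at h2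
  rw [h2]
  exact Finset.sum_congr rfl fun i _ => by simp; ring

theorem det_one_sub_eq_prod_eigenvalues {B : Matrix ι ι ℝ} (hB : B.IsHermitian) :
    (1 - B).det = ∏ i, (1 - hB.eigenvalues i) := by
  have h := congrArg (Polynomial.eval 1) hB.charpoly_eq
  rw [Matrix.eval_charpoly] at h
  simpa [Polynomial.eval_prod] using h

theorem exp_dotProduct_mulVec_eq_prod {B : Matrix ι ι ℝ} (hB : B.IsHermitian) (x : ι → ℝ) :
    Real.exp ((∑ i, x i • hB.eigenvectorBasis i).ofLp ⬝ᵥ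
      (B *ᵥ (∑ i, x i • hB.eigenvectorBasis i).ofLp) / 2) =
      ∏ i, Real.exp (hB.eigenvalues i / 2 * x i ^ 2) := by
  rw [dotProduct_mulVec_sum_eigenvectorBasis, ← Real.exp_sum, Finset.sum_div]
  congr 1
  exact Finset.sum_congr rfl fun i _ => by ring

/-- Coordinates along any orthonormal basis are independent standard Gaussians, so in an eigenbasis
the integrand is a product of one-variable functions. -/
theorem integrable_exp_quadratic_stdGaussian {B : Matrix ι ι ℝ} (hB : B.IsHermitian)
    (h1 : ∀ i, hB.eigenvalues i < 1) :
    Integrable (fun z : EuclideanSpace ℝ ι => Real.exp (z ⬝ᵥ (B *ᵥ z) / 2))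
      (stdGaussian (EuclideanSpace ℝ ι)) := by
  rw [stdGaussian_eq_map_pi_orthonormalBasis hB.eigenvectorBasis,
    integrable_map_measure (by fun_prop) (Measurable.aemeasurable (by fun_prop))]
  simp only [Function.comp_def, exp_dotProduct_mulVec_eq_prod]
  exact Integrable.fintype_prod fun i => integrable_exp_mul_sq_gaussianReal (h1 i)

theorem integral_exp_quadratic_stdGaussian {B : Matrix ι ι ℝ} (hB : B.IsHermitian)
    (h1 : ∀ i, hB.eigenvalues i < 1) :
    ∫ z : EuclideanSpace ℝ ι, Real.exp (z ⬝ᵥ (B *ᵥ z) / 2) ∂(stdGaussian (EuclideanSpace ℝ ι)) =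
      (√(1 - B).det)⁻¹ := by
  rw [stdGaussian_eq_map_pi_orthonormalBasis hB.eigenvectorBasis,
    integral_map (Measurable.aemeasurable (by fun_prop)) (by fun_prop)]
  simp only [exp_dotProduct_mulVec_eq_prod]
  rw [integral_fintype_prod_eq_prod (f := fun i x => Real.exp (hB.eigenvalues i / 2 * x ^ 2)),
    det_one_sub_eq_prod_eigenvalues hB, Real.sqrt_prod _ fun i _ => by linarith [h1 i],
    ← Finset.prod_inv_distrib]
  exact Finset.prod_congr rfl fun i _ => integral_exp_mul_sq_gaussianReal (h1 i)

end GaussianQuadratic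

/-! ### The law of a possibly degenerate centred Gaussian vector -/

section Law

variable {Ω : Type*} [MeasurableSpace Ω]

/-- The quadratic form at `x` is the variance of `∑ x_i X_i`. -/
theorem covMatrix_posSemidef {P : Measure Ω} [IsProbabilityMeasure P] {n : ℕ}
    {X : Fin n → Ω → ℝ} (hX : ∀ i, MemLp (X i) 2 P) : (covMatrix X P).PosSemidef := by
  refine .of_dotProduct_mulVec_nonneg (by ext i j; exact covMatrix_comm X P _ _) fun x => ?_
  have h := covarianceBilin_self_nonneg (μ := P.map fun ω => toLp 2 (X · ω)) (toLp 2 x)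
  rw [covarianceBilin_apply_pi hX] at h
  simpa [dotProduct, Matrix.mulVec, covMatrix, Finset.mul_sum, mul_assoc, mul_left_comm,
    mul_comm] using h

/-- A Gaussian law is determined by its mean and covariance form. -/
theorem map_toLp_eq_multivariateGaussian {P : Measure Ω} [IsProbabilityMeasure P] {n : ℕ}
    {X : Fin n → Ω → ℝ} (hX : HasGaussianLaw (fun ω => fun i => X i ω) P)
    (hmean : ∀ i, ∫ ω, X i ω ∂P = 0) :
    P.map (fun ω => toLp 2 fun i => X i ω) = multivariateGaussian 0 (covMatrix X P) := by
  have hm : ∀ i, MemLp (X i) 2 P := fun i => (hX.eval i).memLp_two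
  have hg : HasGaussianLaw (fun ω => toLp 2 fun i => X i ω) P := hX.toLp_pi 2
  have := hg.isGaussian_map
  apply IsGaussian.ext
  · simp only [id_eq, integral_id_multivariateGaussian]
    rw [integral_map hg.aemeasurable (by fun_prop)]
    ext i
    change EuclideanSpace.proj (𝕜 := ℝ) i (∫ ω, toLp 2 (fun i => X i ω) ∂P) = 0
    rw [← ContinuousLinearMap.integral_comp_comm _ hg.integrable]
    simpa using hmean i
  rw [← ContinuousLinearMap.toBilinForm_inj]
  refine LinearMap.BilinForm.ext_basis (EuclideanSpace.basisFun (Fin n) ℝ).toBasis fun i j ↦ ?_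
  rw [ContinuousLinearMap.toBilinForm_apply, ContinuousLinearMap.toBilinForm_apply,
    covarianceBilin_multivariateGaussian (covMatrix_posSemidef hm)]
  simp only [OrthonormalBasis.coe_toBasis]
  rw [covarianceBilin_apply_basisFun hm]
  simp [covMatrix]

/-- The law of a centred Gaussian vector is the image of the standard Gaussian law under the square
root of the covariance matrix. -/
theorem map_toLp_eq_map_stdGaussian {P : Measure Ω} [IsProbabilityMeasure P] {n : ℕ}
    {X : Fin n → Ω → ℝ} (hX : HasGaussianLaw (fun ω => fun i => X i ω) P)
    (hmean : ∀ i, ∫ ω, X i ω ∂P = 0) : ∃ R : Matrix (Fin n) (Fin n) ℝ,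
    R.IsHermitian ∧ R * R = covMatrix X P ∧
    P.map (fun ω => toLp 2 fun i => X i ω) =
      (stdGaussian (EuclideanSpace ℝ (Fin n))).map (fun z => toEuclideanCLM (𝕜 := ℝ) R z) := by
  open scoped MatrixOrder in
  have hm : ∀ i, MemLp (X i) 2 P := fun i => (hX.eval i).memLp_two
  refine ⟨CFC.sqrt (covMatrix X P), (CFC.sqrt_nonneg _).isSelfAdjoint,
    CFC.sqrt_mul_sqrt_self _ (covMatrix_posSemidef hm).nonneg, ?_⟩
  rw [map_toLp_eq_multivariateGaussian hX hmean, multivariateGaussian]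
  simp

end Law

/-! ### The moment-generating function as a determinant -/

section Coupling

variable {k : ℕ}

/-- The symmetric matrix of the quadratic form `x ↦ 2 * x (idx j false) * x (idx j true)`. -/
def pairMatrix (j : Fin k) : Matrix (Fin (2 * k)) (Fin (2 * k)) ℝ :=
  ∑ b : Bool, Matrix.single (idx j b) (idx j !b) 1

/-- The symmetric matrix of the quadratic form `x ↦ 2 * ∑ j, t j * x (idx j false) * x (idx j true)`,
as a function of the coefficients. -/
def couplingMatrix (t : Fin k → ℝ) : Matrix (Fin (2 * k)) (Fin (2 * k)) ℝ :=
  ∑ j, t j • pairMatrix j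

theorem transpose_pairMatrix (j : Fin k) : (pairMatrix j)ᵀ = pairMatrix j := by
  simp [pairMatrix, Matrix.transpose_add, add_comm]

theorem transpose_couplingMatrix (t : Fin k → ℝ) : (couplingMatrix t)ᵀ = couplingMatrix t := by
  simp [couplingMatrix, Matrix.transpose_sum, transpose_pairMatrix]

theorem continuous_couplingMatrix : Continuous (couplingMatrix (k := k)) := by
  unfold couplingMatrix
  fun_prop

theorem couplingMatrix_zero : couplingMatrix (0 : Fin k → ℝ) = 0 := by
  simp [couplingMatrix]

theorem dotProduct_couplingMatrix_mulVec (t : Fin k → ℝ) (x : Fin (2 * k) → ℝ) :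
    x ⬝ᵥ (couplingMatrix t *ᵥ x) / 2 = ∑ j, t j * (x (idx j false) * x (idx j true)) := by
  simp only [couplingMatrix, Matrix.sum_mulVec, dotProduct_sum, Finset.sum_div]
  refine Finset.sum_congr rfl fun j _ => ?_
  simp only [pairMatrix, Fintype.sum_bool, Matrix.smul_mulVec, Matrix.add_mulVec, dotProduct_add,
    dotProduct_smul, Matrix.single_mulVec_eq, dotProduct_single, Bool.not_true, Bool.not_false,
    smul_eq_mul]
  ring

-- Eigenvalues are bounded by the operator norm, which is continuous in `t` and vanishes at `0`.
open scoped Matrix.Norms.Operator in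
theorem eventually_eigenvalues_lt_one (R : Matrix (Fin (2 * k)) (Fin (2 * k)) ℝ) :
    ∀ᶠ t in 𝓝 (0 : Fin k → ℝ), ∀ h : (R * couplingMatrix t * R).IsHermitian,
      ∀ i, h.eigenvalues i < 1 := by
  have hc : Continuous fun t : Fin k → ℝ => ‖R * couplingMatrix t * R‖ := by
    have := continuous_couplingMatrix (k := k)
    fun_prop
  have h0 : ‖R * couplingMatrix (0 : Fin k → ℝ) * R‖ < 1 := by simp [couplingMatrix_zero]
  filter_upwards [hc.continuousAt.eventually_lt_const h0] with t ht h i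
  have : Nonempty (Fin (2 * k)) := ⟨i⟩
  calc h.eigenvalues i ≤ ‖h.eigenvalues i‖ := Real.le_norm_self _
    _ ≤ ‖R * couplingMatrix t * R‖ :=
      spectrum.norm_le_norm_of_mem (h.eigenvalues_mem_spectrum_real i)
    _ < 1 := ht

variable {Ω : Type*} [MeasurableSpace Ω]

/-- The joint moment-generating function of products of centred Gaussian variables is finite near
the origin, where it is an inverse square root of a determinant. -/
theorem eventually_jointMGF_doublets (P : Measure Ω) [IsProbabilityMeasure P]
    (X : Fin (2 * k) → Ω → ℝ) (hX : HasGaussianLaw (fun ω => fun i => X i ω) P)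
    (hmean : ∀ i, ∫ ω, X i ω ∂P = 0) :
    ∀ᶠ t in 𝓝 (0 : Fin k → ℝ),
      Integrable (fun ω => Real.exp (∑ j, t j * doublets X j ω)) P ∧
      jointMGF (doublets X) P t = (√(1 - covMatrix X P * couplingMatrix t).det)⁻¹ ∧
      0 < (1 - covMatrix X P * couplingMatrix t).det := by
  obtain ⟨R, hR, hRR, hlaw⟩ := map_toLp_eq_map_stdGaussian hX hmean
  have hg : HasGaussianLaw (fun ω => toLp 2 fun i => X i ω) P := hX.toLp_pi 2
  filter_upwards [eventually_eigenvalues_lt_one R] with t ht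
  have hB : (R * couplingMatrix t * R).IsHermitian := by
    have := Matrix.isHermitian_conjTranspose_mul_mul R (A := couplingMatrix t)
      (by simpa [Matrix.IsHermitian] using transpose_couplingMatrix t)
    rwa [hR.eq] at this
  have h1 := ht hB
  -- `det(1 - R(RA)) = det(1 - (RA)R)` replaces the non-symmetric `V A` by a matrix with an
  -- orthonormal eigenbasis, without inverting `V`.
  have hdet : (1 - covMatrix X P * couplingMatrix t).det = (1 - R * couplingMatrix t * R).det := by
    rw [← hRR, mul_assoc, Matrix.det_one_sub_mul_comm]
  let F : EuclideanSpace ℝ (Fin (2 * k)) → ℝ :=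
    fun z => Real.exp (z ⬝ᵥ (couplingMatrix t *ᵥ z) / 2)
  have hF : Measurable F := by fun_prop
  have hform : (fun ω => Real.exp (∑ j, t j * doublets X j ω)) =
      fun ω => F (toLp 2 fun i => X i ω) := by
    funext ω
    simp [F, dotProduct_couplingMatrix_mulVec, doublets]
  have hquad : ∀ z : EuclideanSpace ℝ (Fin (2 * k)),
      (toEuclideanCLM (𝕜 := ℝ) R z).ofLp ⬝ᵥ
        (couplingMatrix t *ᵥ (toEuclideanCLM (𝕜 := ℝ) R z).ofLp) =
      z ⬝ᵥ ((R * couplingMatrix t * R) *ᵥ z) := fun z => by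
    have hT : Rᵀ = R := hR
    rw [Matrix.ofLp_toEuclideanCLM, ← Matrix.mulVec_mulVec, ← Matrix.mulVec_mulVec,
      Matrix.dotProduct_mulVec z.ofLp R, ← Matrix.mulVec_transpose R, hT]
  have hint := integrable_exp_quadratic_stdGaussian hB h1
  have hval := integral_exp_quadratic_stdGaussian hB h1
  simp only [← hquad] at hint hval
  refine ⟨?_, ?_, ?_⟩
  · rw [hform]
    refine Integrable.comp_aemeasurable (g := F) ?_ hg.aemeasurable
    rw [hlaw, integrable_map_measure hF.aestronglyMeasurable (by fun_prop)]
    exact hint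
  · rw [jointMGF, hform, ← integral_map (f := F) hg.aemeasurable hF.aestronglyMeasurable, hlaw,
      integral_map (by fun_prop) hF.aestronglyMeasurable, hval, hdet]
  · rw [hdet, det_one_sub_eq_prod_eigenvalues hB]
    exact Finset.prod_pos fun i _ => by linarith [h1 i]

end Coupling

/-! ### Derivatives of the log-determinant at the origin -/

section LogDet

/-- The determinant is a polynomial `1 - s tr N + s² q(s)`, whose last term has zero derivative at
`0`. -/
theorem hasDerivAt_det_one_sub_smul {ι : Type*} [Fintype ι] [DecidableEq ι] (N : Matrix ι ι ℝ) :
    HasDerivAt (fun s : ℝ => (1 - s • N).det) (-N.trace) 0 := by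
  have h : (fun s : ℝ => (1 - s • N).det) = fun s => 1 + (-N).trace * s +
      (det (1 + (Polynomial.X : Polynomial ℝ) • (-N).map Polynomial.C)).divX.divX.eval s * s ^ 2 := by
    funext s
    rw [← det_one_add_smul, smul_neg, sub_eq_add_neg]
  rw [h]
  have h1 : HasDerivAt (fun s : ℝ => 1 + (-N).trace * s) (-N.trace) 0 := by
    simpa using ((hasDerivAt_id (0 : ℝ)).const_mul (-N).trace).const_add 1
  have h2 := (Polynomial.hasDerivAt (det (1 + (Polynomial.X : Polynomial ℝ) •
    (-N).map Polynomial.C)).divX.divX (0 : ℝ)).mul (hasDerivAt_pow 2 (0 : ℝ))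
  exact (h1.add h2).congr_deriv (by simp)

variable {k : ℕ}

theorem couplingMatrix_add_smul_single (t : Fin k → ℝ) (s : ℝ) (j : Fin k) :
    couplingMatrix (t + s • Pi.single j 1) = couplingMatrix t + s • pairMatrix j := by
  simp only [couplingMatrix, Pi.add_apply, Pi.smul_apply, add_smul, Finset.sum_add_distrib]
  congr 1
  rw [Finset.sum_eq_single j] <;> simp +contextual

theorem couplingMatrix_single (j : Fin k) : couplingMatrix (Pi.single j 1) = pairMatrix j := by
  simpa [couplingMatrix_zero] using couplingMatrix_add_smul_single 0 1 j

theorem contDiff_det_one_sub (V : Matrix (Fin (2 * k)) (Fin (2 * k)) ℝ) (n : WithTop ℕ∞) :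
    ContDiff ℝ n fun t : Fin k → ℝ => (1 - V * couplingMatrix t).det := by
  simp only [det_apply, Matrix.sub_apply, Matrix.mul_apply, couplingMatrix, Matrix.sum_apply,
    Matrix.smul_apply, smul_eq_mul]
  fun_prop

/-- `-1/2` times the logarithm of the determinant of `1 - V * couplingMatrix t`. -/
noncomputable def negHalfLogDet (V : Matrix (Fin (2 * k)) (Fin (2 * k)) ℝ) (t : Fin k → ℝ) : ℝ :=
  -(1 / 2) * Real.log (1 - V * couplingMatrix t).det

theorem contDiffAt_negHalfLogDet (V : Matrix (Fin (2 * k)) (Fin (2 * k)) ℝ) (n : WithTop ℕ∞)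
    {t : Fin k → ℝ} (ht : 0 < (1 - V * couplingMatrix t).det) :
    ContDiffAt ℝ n (negHalfLogDet V) t :=
  contDiffAt_const.mul ((contDiff_det_one_sub V n).contDiffAt.log ht.ne')

/-- This is the push-through identity `V (1 - A V) = (1 - V A) V`. -/
theorem transpose_inv_one_sub_mul {V A : Matrix (Fin (2 * k)) (Fin (2 * k)) ℝ} (hV : Vᵀ = V)
    (hA : Aᵀ = A) (hdet : IsUnit (1 - V * A).det) :
    ((1 - V * A)⁻¹ * V)ᵀ = (1 - V * A)⁻¹ * V := by
  have hdet' : IsUnit (1 - A * V).det := by rwa [det_one_sub_mul_comm]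
  have h : V * (1 - A * V) = (1 - V * A) * V := by noncomm_ring
  rw [transpose_mul, transpose_nonsing_inv, transpose_sub, transpose_one, transpose_mul, hV, hA]
  calc V * (1 - A * V)⁻¹ = (1 - V * A)⁻¹ * ((1 - V * A) * V) * (1 - A * V)⁻¹ := by
        rw [nonsing_inv_mul_cancel_left _ _ hdet]
    _ = (1 - V * A)⁻¹ * V := by
        rw [← h, mul_assoc, mul_assoc, mul_nonsing_inv _ hdet', mul_one]

theorem fderiv_negHalfLogDet {V : Matrix (Fin (2 * k)) (Fin (2 * k)) ℝ} (hV : Vᵀ = V)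
    {t : Fin k → ℝ} (ht : 0 < (1 - V * couplingMatrix t).det) (j : Fin k) :
    fderiv ℝ (negHalfLogDet V) t (Pi.single j 1) =
      ((1 - V * couplingMatrix t)⁻¹ * V) (idx j true) (idx j false) := by
  set M := 1 - V * couplingMatrix t with hM
  have hu : IsUnit M.det := isUnit_iff_ne_zero.2 ht.ne'
  set N := M⁻¹ * V * pairMatrix j with hN
  have hline : HasDerivAt (fun s : ℝ => negHalfLogDet V (t + s • Pi.single j 1))
      (fderiv ℝ (negHalfLogDet V) t (Pi.single j 1)) 0 := by
    have h1 : HasDerivAt (fun s : ℝ => t + s • (Pi.single j 1 : Fin k → ℝ)) (Pi.single j 1) 0 := by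
      simpa using ((hasDerivAt_id (0 : ℝ)).smul_const (Pi.single j 1 : Fin k → ℝ)).const_add t
    refine HasFDerivAt.comp_hasDerivAt (l := negHalfLogDet V) (0 : ℝ) ?_ h1
    simpa using ((contDiffAt_negHalfLogDet V 1 ht).differentiableAt one_ne_zero).hasFDerivAt
  -- Factoring out `M` reduces the derivative at `t` to the derivative of the determinant at the
  -- identity.
  have hdet : ∀ s : ℝ, (1 - V * couplingMatrix (t + s • Pi.single j 1)).det =
      M.det * (1 - s • N).det := fun s => by
    rw [← det_mul, couplingMatrix_add_smul_single]
    congr 1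
    rw [mul_sub, mul_one, mul_smul_comm, hN, mul_assoc, mul_nonsing_inv_cancel_left _ _ hu, hM,
      mul_add, mul_smul_comm, sub_sub]
  have hexp : HasDerivAt (fun s : ℝ => negHalfLogDet V (t + s • Pi.single j 1))
      (1 / 2 * N.trace) 0 := by
    simp only [negHalfLogDet, hdet]
    have h2 := (((hasDerivAt_det_one_sub_smul N).const_mul M.det).log
      (by simpa using ht.ne')).const_mul (-(1 / 2) : ℝ)
    refine h2.congr_deriv ?_
    simp only [zero_smul, sub_zero, det_one, mul_one]
    field_simp
  rw [hline.unique hexp, hN]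
  have hS := transpose_inv_one_sub_mul hV (transpose_couplingMatrix t) hu
  rw [← hM] at hS
  have h3 := congrFun (congrFun hS (idx j true)) (idx j false)
  rw [transpose_apply] at h3
  simp only [pairMatrix, Fintype.sum_bool, mul_add, trace_add, Bool.not_true, Bool.not_false,
    trace_mul_single]
  simp [h3]
  ring

open scoped Matrix.Norms.Operator in
/-- The iterated derivatives at the origin of the entries of `(1 - V * couplingMatrix t)⁻¹ * V`,
read off from the Neumann series. -/
theorem iteratedFDeriv_inv_one_sub_mul (V : Matrix (Fin (2 * k)) (Fin (2 * k)) ℝ)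
    (a b : Fin (2 * k)) (n : ℕ) (v : Fin n → Fin k → ℝ) :
    iteratedFDeriv ℝ n (fun t => ((1 - V * couplingMatrix t)⁻¹ * V) a b) 0 v =
      ∑ σ : Equiv.Perm (Fin n),
        ((List.ofFn fun i => V * couplingMatrix (v (σ i))).prod * V) a b := by
  let T : (Fin k → ℝ) →L[ℝ] Matrix (Fin (2 * k)) (Fin (2 * k)) ℝ :=
    ∑ j, (ContinuousLinearMap.proj j).smulRight (V * pairMatrix j)
  have hT : ∀ t, T t = V * couplingMatrix t := fun t => by
    simp [T, couplingMatrix, Finset.mul_sum]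
  let E : Matrix (Fin (2 * k)) (Fin (2 * k)) ℝ →L[ℝ] ℝ :=
    ((Matrix.entryLinearMap ℝ ℝ a b).comp (LinearMap.mulRight ℝ V)).toContinuousLinearMap
  have hE : ∀ N, E N = (N * V) a b := fun N => by simp [E]
  have h0 := hasFPowerSeriesOnBall_inverse_one_sub ℝ (Matrix (Fin (2 * k)) (Fin (2 * k)) ℝ)
  rw [← map_zero T] at h0
  have h1 := E.comp_hasFPowerSeriesOnBall h0.compContinuousLinearMap
  -- The `n`-th derivative symmetrizes the `n`-th coefficient `x₁ ⋯ xₙ` over all orders of the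
  -- directions, with no `1/n!`.
  have h2 := h1.iteratedFDeriv_eq_sum_of_completeSpace v
  have hf : (fun t => ((1 - V * couplingMatrix t)⁻¹ * V) a b) =
      E ∘ ((fun x : Matrix (Fin (2 * k)) (Fin (2 * k)) ℝ => Ring.inverse (1 - x)) ∘ T) := by
    funext t
    simp [hE, hT, nonsing_inv_eq_ringInverse]
  rw [hf]
  refine h2.trans (Finset.sum_congr rfl fun σ _ => ?_)
  have hprod : (List.ofFn fun i => T (v (σ i))).prod =
      (List.ofFn fun i => V * couplingMatrix (v (σ i))).prod := by simp only [hT]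
  exact (hE _).trans (congrArg (fun N : Matrix (Fin (2 * k)) (Fin (2 * k)) ℝ => (N * V) a b) hprod)

theorem iteratedFDeriv_negHalfLogDet {n : ℕ}
    {V : Matrix (Fin (2 * (n + 1))) (Fin (2 * (n + 1))) ℝ} (hV : Vᵀ = V) :
    iteratedFDeriv ℝ (n + 1) (negHalfLogDet V) 0 (fun i => Pi.single i 1) =
      ∑ σ : Equiv.Perm (Fin n), ((List.ofFn fun i => V * pairMatrix (σ i).succ).prod * V)
        (idx 0 true) (idx 0 false) := by
  have hpos : ∀ᶠ t in 𝓝 (0 : Fin (n + 1) → ℝ), 0 < (1 - V * couplingMatrix t).det := by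
    refine (contDiff_det_one_sub V 0).continuous.continuousAt.eventually_const_lt ?_
    simp [couplingMatrix_zero]
  have hC : ContDiffAt ℝ ⊤ (negHalfLogDet V) 0 := contDiffAt_negHalfLogDet V _ hpos.self_of_nhds
  -- Symmetry of mixed partials moves direction `0` to the last slot, where it is the innermost
  -- derivative.
  rw [← hC.iteratedFDeriv_comp_perm _ (finRotate (n + 1)), iteratedFDeriv_succ_apply_right]
  have hev : (fun t => fderiv ℝ (negHalfLogDet V) t (Pi.single 0 1)) =ᶠ[𝓝 0]
      fun t => ((1 - V * couplingMatrix t)⁻¹ * V) (idx 0 true) (idx 0 false) := by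
    filter_upwards [hpos] with t ht using fderiv_negHalfLogDet hV ht 0
  have hcomm : iteratedFDeriv ℝ n (fun t => fderiv ℝ (negHalfLogDet V) t (Pi.single 0 1)) 0
      (fun i => Pi.single i.succ 1) =
      iteratedFDeriv ℝ n (fderiv ℝ (negHalfLogDet V)) 0 (fun i => Pi.single i.succ 1)
        (Pi.single 0 1) := by
    have h := (ContinuousLinearMap.apply ℝ ℝ (Pi.single 0 1 : Fin (n + 1) → ℝ)).iteratedFDeriv_comp_left
      (f := fderiv ℝ (negHalfLogDet V)) (x := 0) (n := n)
      ((contDiffAt_negHalfLogDet V ⊤ hpos.self_of_nhds).fderiv_right (m := n) le_top) le_rfl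
    have h' := congrArg (fun F => F (fun i : Fin n => (Pi.single i.succ 1 : Fin (n + 1) → ℝ))) h
    simpa [Function.comp_def] using h'
  have hinit : (Fin.init ((fun i => Pi.single i 1 : Fin (n + 1) → Fin (n + 1) → ℝ) ∘
      finRotate (n + 1))) = fun i => Pi.single i.succ 1 := by
    funext i
    simp [Fin.init, finRotate_apply]
  have hlast : ((fun i => Pi.single i 1 : Fin (n + 1) → Fin (n + 1) → ℝ) ∘ finRotate (n + 1))
      (Fin.last n) = Pi.single 0 1 := by
    simp
  rw [hinit, hlast, ← hcomm, (hev.iteratedFDeriv ℝ n).self_of_nhds,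
    iteratedFDeriv_inv_one_sub_mul]
  simp only [couplingMatrix_single]

end LogDet

/-! ### Arrangements, their pairings, and the count -/

section Pairings

variable {k : ℕ}

theorem idx_inj {i j : Fin k} {b c : Bool} : idx i b = idx j c ↔ i = j ∧ b = c := by
  constructor
  · intro h
    have h' := congrArg Fin.val h
    simp only [idx] at h'
    cases b <;> cases c <;> simp at h' ⊢ <;> omega
  · rintro ⟨rfl, rfl⟩
    rfl

theorem exists_idx_eq (x : Fin (2 * k)) : ∃ j b, idx j b = x := by
  refine ⟨⟨x / 2, by omega⟩, decide (x.val % 2 = 1), Fin.ext ?_⟩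
  simp only [idx]
  rcases Nat.mod_two_eq_zero_or_one x.val with h | h <;> simp [h] <;> omega

theorem arrangement_inj {π : Equiv.Perm (Fin k)} {ε : Fin k → Bool} {i j : Fin k} {b c : Bool} :
    arrangement π ε i b = arrangement π ε j c ↔ i = j ∧ b = c := by
  rw [arrangement, arrangement, idx_inj, π.injective.eq_iff]
  constructor
  · rintro ⟨rfl, h⟩
    simpa using h
  · rintro ⟨rfl, rfl⟩
    simp

theorem exists_arrangement_eq (π : Equiv.Perm (Fin k)) (ε : Fin k → Bool) (x : Fin (2 * k)) :
    ∃ j b, arrangement π ε j b = x := by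
  obtain ⟨j, b, rfl⟩ := exists_idx_eq x
  exact ⟨π.symm j, xor b (ε (π.symm j)), by simp [arrangement]⟩

theorem mem_shiftedPairs {π : Equiv.Perm (Fin k)} {ε : Fin k → Bool} {e : Sym2 (Fin (2 * k))} :
    e ∈ shiftedPairs π ε ↔
      ∃ j, s(arrangement π ε j true, arrangement π ε (finRotate k j) false) = e := by
  simp [shiftedPairs]

theorem isPairing_shiftedPairs (π : Equiv.Perm (Fin k)) (ε : Fin k → Bool) :
    IsPairing (shiftedPairs π ε) := by
  refine ⟨fun e he => ?_, fun i => ?_⟩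
  · obtain ⟨j, rfl⟩ := mem_shiftedPairs.1 he
    simp [arrangement_inj]
  · obtain ⟨j, b, rfl⟩ := exists_arrangement_eq π ε i
    cases b
    · refine ⟨s(arrangement π ε ((finRotate k).symm j) true,
        arrangement π ε (finRotate k ((finRotate k).symm j)) false),
        ⟨mem_shiftedPairs.2 ⟨_, rfl⟩,
          Sym2.mem_iff.2 (Or.inr (by rw [Equiv.apply_symm_apply]))⟩, ?_⟩
      rintro e ⟨he, hm⟩
      obtain ⟨l, rfl⟩ := mem_shiftedPairs.1 he
      rw [Sym2.mem_iff, arrangement_inj, arrangement_inj] at hm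
      have h : j = finRotate k l := by simpa using hm
      rw [h, Equiv.symm_apply_apply]
    · refine ⟨_, ⟨mem_shiftedPairs.2 ⟨j, rfl⟩, by simp⟩, ?_⟩
      rintro e ⟨he, hm⟩
      obtain ⟨l, rfl⟩ := mem_shiftedPairs.1 he
      rw [Sym2.mem_iff, arrangement_inj, arrangement_inj] at hm
      have h : j = l := by simpa using hm
      rw [h]

theorem IsPairing.eq_of_mem {n : ℕ} {p : Finset (Sym2 (Fin n))} (hp : IsPairing p)
    {a b c : Fin n} (hb : s(a, b) ∈ p) (hc : s(a, c) ∈ p) : b = c := by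
  have h := (hp.2 a).unique ⟨hb, by simp⟩ ⟨hc, by simp⟩
  exact Sym2.congr_right.1 h

theorem IsPairing.eq_of_subset {n : ℕ} {p q : Finset (Sym2 (Fin n))} (hp : IsPairing p)
    (hq : IsPairing q) (h : p ⊆ q) : p = q := by
  refine h.antisymm fun e he => ?_
  induction e with | _ a b =>
  obtain ⟨e', ⟨he', ha⟩, -⟩ := hp.2 a
  rwa [(hq.2 a).unique ⟨he, by simp⟩ ⟨h he', ha⟩]

theorem prod_shiftedPairs {M : Type*} [CommMonoid M] (π : Equiv.Perm (Fin k)) (ε : Fin k → Bool)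
    (f : Sym2 (Fin (2 * k)) → M) :
    ∏ e ∈ shiftedPairs π ε, f e =
      ∏ j, f s(arrangement π ε j true, arrangement π ε (finRotate k j) false) := by
  refine Finset.prod_image fun i _ j _ h => ?_
  simpa [arrangement_inj] using h

/-- The partner of the second entry in one place is the first entry in the next, so the pairing and
the initial place determine everything along the cycle. -/
theorem shiftedPairs_injective {n : ℕ} {π π' : Equiv.Perm (Fin (n + 1))}
    {ε ε' : Fin (n + 1) → Bool} (h0 : π 0 = π' 0) (h0' : ε 0 = ε' 0)
    (h : shiftedPairs π ε = shiftedPairs π' ε') : π = π' ∧ ε = ε' := by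
  have key : ∀ j, π j = π' j ∧ ε j = ε' j := by
    intro j
    induction j using Fin.induction with
    | zero => exact ⟨h0, h0'⟩
    | succ i ih =>
      have h1 : s(arrangement π ε i.castSucc true, arrangement π ε i.succ false) ∈
          shiftedPairs π ε := mem_shiftedPairs.2 ⟨i.castSucc, by simp⟩
      have h2 : s(arrangement π ε i.castSucc true, arrangement π' ε' i.succ false) ∈
          shiftedPairs π ε := by
        rw [h]
        exact mem_shiftedPairs.2 ⟨i.castSucc, by simp [arrangement, ih]⟩
      simpa [arrangement, idx_inj] using (isPairing_shiftedPairs π ε).eq_of_mem h1 h2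
  exact ⟨Equiv.ext fun j => (key j).1, funext fun j => (key j).2⟩

theorem mem_cyclicPairings {n : ℕ} {p : Finset (Sym2 (Fin (2 * (n + 1))))} :
    p ∈ cyclicPairings (n + 1) ↔
      ∃ π ε, (π 0 = 0 ∧ ε 0 = false) ∧ shiftedPairs π ε = p := by
  simp [cyclicPairings]

/-- The normalized arrangements are parametrized by the permutations of the other pairs and the
interchanges inside them. -/
theorem cyclicPairings_eq_image (n : ℕ) : cyclicPairings (n + 1) =
    (Finset.univ : Finset (Equiv.Perm (Fin n) × (Fin n → Bool))).image fun a =>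
      shiftedPairs (Equiv.Perm.decomposeFin.symm (0, a.1)) (Fin.cons false a.2) := by
  ext p
  simp only [mem_cyclicPairings, Finset.mem_image, Finset.mem_univ, true_and, Prod.exists]
  constructor
  · rintro ⟨π, ε, ⟨h0, h1⟩, rfl⟩
    obtain ⟨⟨c, σ⟩, rfl⟩ := Equiv.Perm.decomposeFin.symm.surjective π
    rw [Equiv.Perm.decomposeFin_symm_apply_zero] at h0
    refine ⟨σ, Fin.tail ε, ?_⟩
    rw [h0, ← h1, Fin.cons_self_tail]
  · rintro ⟨σ, δ, rfl⟩
    exact ⟨_, _, ⟨by simp, by simp⟩, rfl⟩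

theorem injective_shiftedPairs_decomposeFin (n : ℕ) : Function.Injective
    fun a : Equiv.Perm (Fin n) × (Fin n → Bool) =>
      shiftedPairs (Equiv.Perm.decomposeFin.symm (0, a.1)) (Fin.cons false a.2) := by
  rintro ⟨σ, δ⟩ ⟨σ', δ'⟩ h
  obtain ⟨h1, h2⟩ := shiftedPairs_injective (by simp) (by simp) h
  have h3 := Equiv.Perm.decomposeFin.symm.injective h1
  have h4 := Fin.cons_right_injective _ h2
  simp_all

theorem card_cyclicPairings (n : ℕ) : (cyclicPairings (n + 1)).card = n.factorial * 2 ^ n := by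
  rw [cyclicPairings_eq_image, Finset.card_image_of_injective _
    (injective_shiftedPairs_decomposeFin n)]
  simp [Fintype.card_perm]

/-- A shifted pair joins consecutive places, and these differ once there are at least two. -/
theorem not_mem_of_mem_originalPairs {n : ℕ} (hn : 2 ≤ n + 1)
    {p : Finset (Sym2 (Fin (2 * (n + 1))))} (hp : p ∈ cyclicPairings (n + 1))
    {e : Sym2 (Fin (2 * (n + 1)))} (he : e ∈ originalPairs (n + 1)) : e ∉ p := by
  obtain ⟨π, ε, -, rfl⟩ := mem_cyclicPairings.1 hp
  intro h
  obtain ⟨j, rfl⟩ := mem_shiftedPairs.1 h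
  simp only [originalPairs, Finset.mem_image, Finset.mem_univ, true_and] at he
  obtain ⟨q, hq⟩ := he
  have h1 : π j = π (finRotate (n + 1) j) := by
    simp only [Sym2.eq_iff, arrangement, idx_inj] at hq
    rcases hq with hq | hq
    · exact hq.1.1.symm.trans hq.2.1
    · exact hq.2.1.symm.trans hq.1.1
  have h2 := π.injective h1
  obtain ⟨m, rfl⟩ : ∃ m, n = m + 1 := ⟨n - 1, by omega⟩
  simp at h2

end Pairings

/-! ### Cyclic pairings are the connected pairings -/

section Connected

theorem pairingGraph_adj {k : ℕ} {p : Finset (Sym2 (Fin (2 * k)))} {x y : Fin (2 * k)} :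
    (pairingGraph p).Adj x y ↔ (s(x, y) ∈ p ∨ s(x, y) ∈ originalPairs k) ∧ x ≠ y := by
  simp [pairingGraph, or_and_right]

theorem connected_pairingGraph_shiftedPairs {n : ℕ} (π : Equiv.Perm (Fin (n + 1)))
    (ε : Fin (n + 1) → Bool) : (pairingGraph (shiftedPairs π ε)).Connected := by
  have hin : ∀ j, (pairingGraph (shiftedPairs π ε)).Reachable
      (arrangement π ε j false) (arrangement π ε j true) := fun j => by
    refine SimpleGraph.Adj.reachable (pairingGraph_adj.2 ⟨Or.inr ?_, by simp [arrangement_inj]⟩)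
    simp only [originalPairs, Finset.mem_image, Finset.mem_univ, true_and]
    refine ⟨π j, ?_⟩
    cases h : ε j <;> simp [arrangement, h]
  have hout : ∀ i : Fin n, (pairingGraph (shiftedPairs π ε)).Reachable
      (arrangement π ε i.castSucc true) (arrangement π ε i.succ false) := fun i =>
    SimpleGraph.Adj.reachable (pairingGraph_adj.2
      ⟨Or.inl (mem_shiftedPairs.2 ⟨i.castSucc, by simp⟩), by simp [arrangement_inj]⟩)
  have hall : ∀ j, (pairingGraph (shiftedPairs π ε)).Reachable
      (arrangement π ε 0 false) (arrangement π ε j false) := by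
    intro j
    induction j using Fin.induction with
    | zero => rfl
    | succ i ih => exact (ih.trans (hin _)).trans (hout i)
  rw [SimpleGraph.connected_iff_exists_forall_reachable]
  refine ⟨arrangement π ε 0 false, fun x => ?_⟩
  obtain ⟨j, b, rfl⟩ := exists_arrangement_eq π ε x
  cases b
  · exact hall j
  · exact (hall j).trans (hin j)

/-- The orbits of the product of two fixed-point-free involutions contain no two points that the
second involution exchanges. -/
theorem iterate_comp_ne_of_involutive {α : Type*} {μ ι : α → α} (hμ : Function.Involutive μ)
    (hι : Function.Involutive ι) (hμ' : ∀ x, μ x ≠ x) (hι' : ∀ x, ι x ≠ x) (d : ℕ) (y : α) :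
    (μ ∘ ι)^[d] y ≠ ι y := by
  induction d using Nat.twoStepInduction generalizing y with
  | zero => exact (hι' y).symm
  | one => exact hμ' (ι y)
  | more d ih _ =>
    intro h
    rw [Function.iterate_succ_apply, Function.iterate_succ_apply'] at h
    -- Cancelling the outer `μ ∘ ι` lowers the exponent by two at the new point `μ (ι y)`; the base
    -- cases would be fixed points of `ι` or `μ`.
    refine ih ((μ ∘ ι) y) ?_
    have h' := congrArg (fun z => ι (μ z)) h
    simpa [hμ _, hι _] using h'

/-- Let `μ` exchange partners in `p` and `ι` partners in original pairs. The orbit of the first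
index under `μ ∘ ι` lists the first entries of consecutive places, and `ι` gives the second entries.
-/
theorem mem_cyclicPairings_of_connected {n : ℕ} {p : Finset (Sym2 (Fin (2 * (n + 1))))}
    (hp : IsPairing p) (hc : (pairingGraph p).Connected) : p ∈ cyclicPairings (n + 1) := by
  have hex : ∀ x, ∃ y, s(x, y) ∈ p := fun x => by
    obtain ⟨e, ⟨he, hx⟩, -⟩ := hp.2 x
    obtain ⟨y, rfl⟩ := Sym2.mem_iff_exists.1 hx
    exact ⟨y, he⟩
  choose μ hμ using hex
  choose pos bit hidx using fun x : Fin (2 * (n + 1)) => exists_idx_eq x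
  have hpb : ∀ j b, pos (idx j b) = j ∧ bit (idx j b) = b := fun j b => idx_inj.1 (hidx _)
  let ι : Fin (2 * (n + 1)) → Fin (2 * (n + 1)) := fun x => idx (pos x) (!bit x)
  have hι2 : Function.Involutive ι := fun x => by simp [ι, hpb, hidx]
  have hι1 : ∀ x, ι x ≠ x := fun x h => by
    have := (hpb (pos x) (!bit x)).2
    simp only [ι] at h
    rw [h] at this
    simp at this
  have hμ2 : Function.Involutive μ := fun x =>
    hp.eq_of_mem (hμ (μ x)) (by rw [Sym2.eq_swap]; exact hμ x)
  have hμ1 : ∀ x, μ x ≠ x := fun x h => hp.1 _ (hμ x) (by simp [h])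
  have hpos : ∀ x y, pos x = pos y → x = y ∨ x = ι y := fun x y h => by
    rw [← hidx x, ← hidx y, h]
    simp only [ι, hpb, idx_inj, true_and]
    cases bit x <;> cases bit y <;> simp
  set g : Fin (2 * (n + 1)) → Fin (2 * (n + 1)) := μ ∘ ι with hg
  have hginj : Function.Injective g := hμ2.injective.comp hι2.injective
  let x₀ : Fin (2 * (n + 1)) := idx 0 false
  set m := Function.minimalPeriod g x₀ with hm
  have hm0 : 0 < m := Function.minimalPeriod_pos_of_mem_periodicPts
    (hginj.mem_periodicPts x₀)
  have hgm : g^[m] x₀ = x₀ := Function.iterate_minimalPeriod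
  have hne : ∀ i j, g^[i] x₀ ≠ ι (g^[j] x₀) := fun i j h => by
    rcases le_total j i with hij | hij
    · obtain ⟨d, rfl⟩ := Nat.exists_eq_add_of_le' hij
      rw [Function.iterate_add_apply] at h
      exact iterate_comp_ne_of_involutive hμ2 hι2 hμ1 hι1 _ _ h
    · obtain ⟨d, rfl⟩ := Nat.exists_eq_add_of_le' hij
      rw [Function.iterate_add_apply] at h
      exact iterate_comp_ne_of_involutive hμ2 hι2 hμ1 hι1 d (g^[i] x₀)
        ((congrArg ι h).trans (hι2 _)).symm
  -- The orbit together with its `ι`-image is closed under adjacency, so by connectedness it is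
  -- everything.
  have hstep : ∀ x y, (pairingGraph p).Adj x y → (∃ i, y = g^[i] x₀ ∨ y = ι (g^[i] x₀)) →
      ∃ i, x = g^[i] x₀ ∨ x = ι (g^[i] x₀) := by
    rintro x y hxy ⟨i, hi⟩
    rcases (pairingGraph_adj.1 hxy.symm).1 with h | h
    · obtain rfl : x = μ y := hp.eq_of_mem h (hμ y)
      rcases hi with rfl | rfl
      -- One step back along the orbit, taken modulo the period so that `i = 0` is covered.
      · refine ⟨i + (m - 1), Or.inr (hμ2.injective ?_)⟩
        rw [hμ2]
        change _ = g (g^[i + (m - 1)] x₀)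
        rw [← Function.iterate_succ_apply' g, Nat.succ_eq_add_one,
          show i + (m - 1) + 1 = i + m by omega, Function.iterate_add_apply, hgm]
      · exact ⟨i + 1, Or.inl (Function.iterate_succ_apply' g i x₀).symm⟩
    · obtain rfl : x = ι y := by
        simp only [originalPairs, Finset.mem_image, Finset.mem_univ, true_and, Sym2.eq_iff] at h
        rcases h with ⟨q, ⟨rfl, rfl⟩ | ⟨rfl, rfl⟩⟩ <;> simp [ι, hpb]
      rcases hi with rfl | rfl
      · exact ⟨i, Or.inr rfl⟩
      · exact ⟨i, Or.inl (hι2 _)⟩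
  have horb : ∀ x, ∃ i, x = g^[i] x₀ ∨ x = ι (g^[i] x₀) := by
    have hwalk : ∀ x y, (pairingGraph p).Walk x y → (∃ i, y = g^[i] x₀ ∨ y = ι (g^[i] x₀)) →
        ∃ i, x = g^[i] x₀ ∨ x = ι (g^[i] x₀) := fun x y w hy => by
      induction w with
      | nil => exact hy
      | cons h _ ih => exact hstep _ _ h (ih hy)
    intro x
    obtain ⟨w⟩ := hc.preconnected x x₀
    exact hwalk x x₀ w ⟨0, Or.inl rfl⟩
  -- One period visits each original pair exactly once, by `hne` and `horb`; this forces `m = n +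
  -- 1`.
  have hbij : Function.Bijective fun i : Fin m => pos (g^[i] x₀) := by
    constructor
    · intro i j h
      have h' := (hpos _ _ h).resolve_right (hne _ _)
      exact Fin.ext (Function.iterate_injOn_Iio_minimalPeriod i.2 j.2 h')
    · intro q
      obtain ⟨i, hi⟩ := horb (idx q false)
      refine ⟨⟨i % m, Nat.mod_lt _ hm0⟩, ?_⟩
      simp only [hm, Function.iterate_mod_minimalPeriod_eq]
      rcases hi with hi | hi
      · rw [← hi, (hpb _ _).1]
      · have := congrArg pos hi
        simpa [ι, hpb] using this.symm
  have hmk : m = n + 1 := by simpa using Fintype.card_of_bijective hbij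
  clear_value m
  subst hmk
  -- With this choice the first entry in place `i` is `g^[i] x₀` and the second is its image under
  -- `ι`.
  refine mem_cyclicPairings.2 ⟨Equiv.ofBijective _ hbij, fun i => bit (g^[i] x₀),
    ⟨by simp [x₀, hpb], by simp [x₀, hpb]⟩, ?_⟩
  refine IsPairing.eq_of_subset (isPairing_shiftedPairs _ _) hp fun e he => ?_
  obtain ⟨j, rfl⟩ := mem_shiftedPairs.1 he
  have hrot : g^[(finRotate (n + 1) j : Fin (n + 1))] x₀ = g (g^[j] x₀) := by
    rw [← Function.iterate_succ_apply' g]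
    rcases Fin.eq_castSucc_or_eq_last j with ⟨i, rfl⟩ | rfl
    · simp
    · rw [finRotate_last]
      exact hgm.symm
  convert hμ (ι (g^[j] x₀)) using 3
  · simp [arrangement, ι]
  · change idx (pos (g^[(finRotate (n + 1) j : Fin (n + 1))] x₀))
      (xor false (bit (g^[(finRotate (n + 1) j : Fin (n + 1))] x₀))) = _
    rw [hrot, Bool.false_xor, hidx]
    rfl

theorem mem_cyclicPairings_iff {n : ℕ} (p : Finset (Sym2 (Fin (2 * (n + 1))))) :
    p ∈ cyclicPairings (n + 1) ↔ IsPairing p ∧ (pairingGraph p).Connected := by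
  refine ⟨fun h => ?_, fun h => mem_cyclicPairings_of_connected h.1 h.2⟩
  obtain ⟨π, ε, -, rfl⟩ := mem_cyclicPairings.1 h
  exact ⟨isPairing_shiftedPairs π ε, connected_pairingGraph_shiftedPairs π ε⟩

end Connected

/-! ### Expanding the matrix products into pairings -/

section Expansion

theorem mul_pairMatrix_mul_apply {k : ℕ} (V N : Matrix (Fin (2 * k)) (Fin (2 * k)) ℝ) (j : Fin k)
    (a b : Fin (2 * k)) :
    (V * pairMatrix j * N) a b = ∑ c : Bool, V a (idx j c) * N (idx j !c) b := by
  simp only [pairMatrix, Finset.mul_sum, Finset.sum_mul, Matrix.sum_apply, mul_assoc]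
  refine Finset.sum_congr rfl fun c _ => ?_
  simp [Matrix.mul_apply, Matrix.single_apply, ite_and]

/-- An entry of an alternating product of `V` with matrices of original pairs is a sum over the
orientations of these pairs. -/
theorem prod_mul_pairMatrix_apply {k n : ℕ} (V : Matrix (Fin (2 * k)) (Fin (2 * k)) ℝ)
    (c : Fin n → Fin k) (a b : Fin (2 * k)) :
    ((List.ofFn fun i => V * pairMatrix (c i)).prod * V) a b =
      ∑ δ : Fin n → Bool, ∏ j : Fin (n + 1),
        V ((Fin.cons a fun i => idx (c i) !(δ i) : Fin (n + 1) → Fin (2 * k)) j)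
          ((Fin.snoc (fun i => idx (c i) (δ i)) b : Fin (n + 1) → Fin (2 * k)) j) := by
  induction n generalizing a with
  | zero => simp [Fin.snoc]
  | succ n ih =>
    rw [List.ofFn_succ, List.prod_cons, mul_assoc, mul_pairMatrix_mul_apply,
      ← (Fin.consEquiv fun _ : Fin (n + 1) => Bool).sum_comp, Fintype.sum_prod_type]
    refine Finset.sum_congr rfl fun d _ => ?_
    rw [ih, Finset.mul_sum]
    refine Finset.sum_congr rfl fun δ _ => ?_
    have hsnoc : (Fin.snoc (fun i => idx (c i) ((Fin.cons d δ : Fin (n + 1) → Bool) i)) b :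
        Fin (n + 2) → Fin (2 * k)) =
        Fin.cons (idx (c 0) d) (Fin.snoc (fun i => idx (c i.succ) (δ i)) b) := by
      rw [Fin.cons_snoc_eq_snoc_cons]
      congr 1
      funext i
      cases i using Fin.cases <;> simp
    have hcons : (fun i => idx (c i) !((Fin.cons d δ : Fin (n + 1) → Bool) i)) =
        Fin.cons (idx (c 0) !d) fun i => idx (c i.succ) !(δ i) := by
      funext i
      cases i using Fin.cases <;> simp
    simp only [Fin.consEquiv, Equiv.coe_fn_mk]
    rw [hsnoc, hcons, Fin.prod_univ_succ (n := n + 1)]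
    simp only [Fin.cons_zero, Fin.cons_succ]

/-- The `j`-th factor `V` has as row the second entry in place `j` and as column the first entry in
the next place; the outer indices `idx 0 true` and `idx 0 false` close the cycle. -/
theorem sum_prod_mul_pairMatrix_eq {n : ℕ} {Ω : Type*} [MeasurableSpace Ω] (P : Measure Ω)
    (X : Fin (2 * (n + 1)) → Ω → ℝ) :
    ∑ σ : Equiv.Perm (Fin n),
      ((List.ofFn fun i => covMatrix X P * pairMatrix (σ i).succ).prod * covMatrix X P)
        (idx 0 true) (idx 0 false) =
      ∑ p ∈ cyclicPairings (n + 1), ∏ e ∈ p, covEntry X P e := by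
  rw [cyclicPairings_eq_image, Finset.sum_image (injective_shiftedPairs_decomposeFin n).injOn,
    Fintype.sum_prod_type]
  refine Finset.sum_congr rfl fun σ _ => ?_
  rw [prod_mul_pairMatrix_apply]
  refine Finset.sum_congr rfl fun δ _ => ?_
  rw [prod_shiftedPairs]
  refine Finset.prod_congr rfl fun j _ => ?_
  change _ = covMatrix X P _ _
  congr 1
  · cases j using Fin.cases <;> simp [arrangement]
  · cases j using Fin.lastCases <;> simp [arrangement]

end Expansion

theorem jointCGF_doublets_eventuallyEq {k : ℕ} {Ω : Type*} [MeasurableSpace Ω] (P : Measure Ω)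
    [IsProbabilityMeasure P] (X : Fin (2 * k) → Ω → ℝ)
    (hX : HasGaussianLaw (fun ω => fun i => X i ω) P) (hmean : ∀ i, ∫ ω, X i ω ∂P = 0) :
    jointCGF (doublets X) P =ᶠ[𝓝 0] negHalfLogDet (covMatrix X P) := by
  filter_upwards [eventually_jointMGF_doublets P X hX hmean] with t ⟨_, h, hpos⟩
  rw [jointCGF, h, negHalfLogDet, Real.log_inv, Real.log_sqrt hpos.le]
  ring

end DoubletCumulant

open DoubletCumulant in
theorem mainTheorem1 {Ω : Type*} [MeasurableSpace Ω] (P : Measure Ω) [IsProbabilityMeasure P]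
    (k : ℕ) (hk : 1 ≤ k) (X : Fin (2 * k) → Ω → ℝ)
    (hX : HasGaussianLaw (fun ω => fun i => X i ω) P)
    (hmean : ∀ i, ∫ ω, X i ω ∂P = 0) :
    -- the cumulant exists: the moment-generating function of the products is finite near `0`
    -- and its logarithm is `k` times continuously differentiable there
    (∀ᶠ t in 𝓝 (0 : Fin k → ℝ),
        Integrable (fun ω => Real.exp (∑ j, t j * doublets X j ω)) P) ∧
    ContDiffAt ℝ k (jointCGF (doublets X) P) 0 ∧
    -- the formula
    jointCumulant (doublets X) P = ∑ p ∈ cyclicPairings k, ∏ e ∈ p, covEntry X P e ∧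
    -- the number of terms
    (cyclicPairings k).card = (k - 1).factorial * 2 ^ (k - 1) ∧
    -- no original pair occurs
    (2 ≤ k → ∀ p ∈ cyclicPairings k, ∀ e ∈ originalPairs k, e ∉ p) ∧
    -- the class consists of exactly the connected pairings
    (∀ p : Finset (Sym2 (Fin (2 * k))),
        p ∈ cyclicPairings k ↔ IsPairing p ∧ (pairingGraph p).Connected) := by
  obtain ⟨n, rfl⟩ : ∃ n, k = n + 1 := ⟨k - 1, by omega⟩
  have hmgf := eventually_jointMGF_doublets P X hX hmean
  have hcgf := jointCGF_doublets_eventuallyEq P X hX hmean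
  have hV : (covMatrix X P).transpose = covMatrix X P :=
    Matrix.ext fun i j => covMatrix_comm X P j i
  refine ⟨hmgf.mono fun t h => h.1, ?_, ?_, card_cyclicPairings n,
    fun h p hp e he => not_mem_of_mem_originalPairs h hp he, mem_cyclicPairings_iff⟩
  · exact (contDiffAt_negHalfLogDet _ _ hmgf.self_of_nhds.2.2).congr_of_eventuallyEq hcgf
  · rw [jointCumulant, (hcgf.iteratedFDeriv ℝ (n + 1)).self_of_nhds,
      iteratedFDeriv_negHalfLogDet hV, sum_prod_mul_pairMatrix_eq]
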